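/- Let $\mathbb X=(X_n,n\ge 1)$ be a strictly stationary sequence of real random variables on a probability space $(\Omega,\mathcal F,\mathbb P)$, let $a>0$, and let $(k_n,n\ge 1)$ be a sequence of integers with $1\le k_n\le n$ for all $n\ge 1$ and $k_n/n\to 1$. Let $\mathcal I^{\mathbb X}$ be the sigma-field of all sets $A\subseteq\Omega$ for which there is a Borel set $B\subseteq\mathbb R^{\mathbb N}$ such that $A=\{\omega:(X_i(\omega),X_{i+1}(\omega),\ldots)\in B\}$ for every $i\ge 1$. Let $\gamma_1=\gamma_1(X_1|\mathcal I^{\mathbb X})$ be (any version of) the conditional right endpoint of the support of $X_1$ given $\mathcal I^{\mathbb X}$, that is, an $\mathcal I^{\mathbb X}$-measurable function $\Omega\to[-\infty,\infty]$ such that $\mathbb P(X_1\le\gamma_1|\mathcal I^{\mathbb X})=1$ a.s. and such that $\gamma_1\le Q$ a.s. for every $\mathcal I^{\mathbb X}$-measurable $Q:\Omega\to[-\infty,\infty]$ with $\mathbb P(X_1\le Q|\mathcal I^{\mathbb X})=1$ a.s. Assume that $$\mathbb P(X_1=\gamma_1)=0\quad\text{and}\quad \mathbb P(X_1=\gamma_1-a)=0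 .$$ Let $(N(t),t\ge 0)$ be a family of nonnegative integer-valued random variables on the same space (not assumed independent of $\mathbb X$), and put $$\mathcal K_t(k_{N(t)},a)=\sum_{i=1}^{N(t)} I\big(X_{k_{N(t)}:N(t)}-a<X_i<X_{k_{N(t)}:N(t)}\big),$$ where $X_{k:n}$ is the $k$-th smallest of $X_1,\ldots,X_n$ (and the sum is $0$ when $N(t)=0$). If $N(t)\to\infty$ a.s. as $t\to\infty$, then $$\frac{\mathcal K_t(k_{N(t)},a)}{N(t)}\longrightarrow I(\gamma_1<\infty)\cdot\mathbb P\big(X_1>\gamma_1-a\,\big|\,\mathcal I^{\mathbb X}\big)\quad\text{a.s. as }t\to\infty .$$ If instead $N(t)\to\infty$ in probability as $t\to\infty$, i.e. $\mathbb P(N(t)\le D)\to 0$ for every real $D$, then the same convergence holds in probability. (The quotient is read as $0$ when $N(t)=0$.) -/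

import Mathlib

open MeasureTheory ProbabilityTheory Filter Topology
open scoped NNReal ENNReal

namespace NearMax

/-- A process `(X₁, X₂, …)` is indexed from `0` in Lean, so `X i` stands for `X_{i+1}`.
It is strictly stationary when the law of the whole sequence is invariant under every shift. -/
def StrictlyStationary {Ω : Type*} [MeasurableSpace Ω] (μ : Measure Ω) (X : ℕ → Ω → ℝ) : Prop :=
  ∀ h : ℕ, IdentDistrib (fun ω (j : ℕ) => X (h + j) ω) (fun ω (j : ℕ) => X j ω) μ μ

/-- The sigma-field of sets invariant with respect to the sequence `X`: the sets `A` for which there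
is one Borel set `B` of real sequences with `A = {ω | (X_i(ω), X_{i+1}(ω), …) ∈ B}` for all `i`. -/
@[reducible] def invariantSigma {Ω : Type*} (X : ℕ → Ω → ℝ) : MeasurableSpace Ω where
  MeasurableSet' A := ∃ B : Set (ℕ → ℝ), MeasurableSet B ∧
    ∀ i : ℕ, A = {ω | (fun j : ℕ => X (i + j) ω) ∈ B}
  measurableSet_empty := ⟨∅, MeasurableSet.empty, fun i => by simp⟩
  measurableSet_compl := by
    rintro A ⟨B, hB, hA⟩
    refine ⟨Bᶜ, hB.compl, fun i => ?_⟩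
    conv_lhs => rw [hA i]
    rfl
  measurableSet_iUnion := by
    intro f hf
    choose B hB hA using hf
    refine ⟨⋃ n, B n, MeasurableSet.iUnion hB, fun i => ?_⟩
    ext ω
    simp only [Set.mem_iUnion, Set.mem_ofPred_eq]
    refine exists_congr fun n => ?_
    conv_lhs => rw [hA n i]
    rfl

theorem invariantSigma_le {Ω : Type*} [m0 : MeasurableSpace Ω] {X : ℕ → Ω → ℝ}
    (hX : ∀ i, Measurable (X i)) : invariantSigma X ≤ m0 := by
  rintro A ⟨B, hB, hA⟩
  rw [hA 0]
  exact measurableSet_preimage (measurable_pi_lambda _ fun j => hX (0 + j)) hB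

/-- `γ` is (a version of) the conditional right endpoint of the support of `X` given `G`: the
a.s. smallest `G`-measurable extended random variable `Q` with `P(X ≤ Q | G) = 1` a.s. -/
structure IsCondRightEndpoint {Ω : Type*} [m0 : MeasurableSpace Ω] (μ : Measure Ω)
    (G : MeasurableSpace Ω) (X : Ω → ℝ) (γ : Ω → EReal) : Prop where
  measurable : Measurable[G] γ
  condProb_le : μ⟦{ω | (X ω : EReal) ≤ γ ω}|G⟧ =ᵐ[μ] fun _ => 1
  minimal : ∀ Q : Ω → EReal, Measurable[G] Q →
    μ⟦{ω | (X ω : EReal) ≤ Q ω}|G⟧ =ᵐ[μ] (fun _ => 1) → ∀ᵐ ω ∂μ, γ ω ≤ Q ω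

/-- The conditional right endpoint of the support exists. -/
theorem exists_isCondRightEndpoint {Ω : Type*} {G : MeasurableSpace Ω}
    [m0 : MeasurableSpace Ω] (μ : Measure Ω) [IsProbabilityMeasure μ] (hG : G ≤ m0) {X : Ω → ℝ}
    (hX : Measurable X) : ∃ γ : Ω → EReal, IsCondRightEndpoint μ G X γ := by
  -- on a set of `G`, `X ≤ Q` holds a.s. exactly when the conditional probability is one there
  have key : ∀ s : Set Ω, MeasurableSet s → ∀ A : Set Ω, MeasurableSet[G] A →
      ((∀ᵐ ω ∂μ, ω ∈ A → (μ⟦s|G⟧) ω = 1) ↔ ∀ᵐ ω ∂μ, ω ∈ A → ω ∈ s) := by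
    intro s hs A hA
    have hint : Integrable (s.indicator fun _ => (1 : ℝ)) μ := (integrable_const 1).indicator hs
    have hset := setIntegral_condExp hG hint hA
    have hA' := hG A hA
    constructor
    · intro h
      have h1 : ∫ ω in A, (μ⟦s|G⟧) ω ∂μ = ∫ ω in A, (1 : ℝ) ∂μ :=
        setIntegral_congr_ae hA' h
      rw [h1] at hset
      have h2 : ∫ ω in A, (1 - s.indicator (fun _ => (1 : ℝ)) ω) ∂μ = 0 := by
        rw [integral_sub (integrable_const 1) hint.integrableOn, hset, sub_self]
      rw [setIntegral_eq_zero_iff_of_nonneg_ae] at h2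
      · rw [Filter.EventuallyEq, ae_restrict_iff' hA'] at h2
        filter_upwards [h2] with ω hω hωA
        by_contra hns
        simpa [hns] using hω hωA
      · refine Eventually.of_forall fun ω => ?_
        by_cases hω : ω ∈ s <;> simp [hω]
      · exact ((integrable_const 1).sub hint).integrableOn
    · intro h
      have h1 : (A.indicator (s.indicator fun _ => (1 : ℝ))) =ᵐ[μ] A.indicator fun _ => 1 := by
        filter_upwards [h] with ω hω
        by_cases hA1 : ω ∈ A
        · simp [hA1, hω hA1]
        · simp [hA1]
      have h2 := (condExp_congr_ae (m := G) h1).symm.trans (condExp_indicator hint hA)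
      rw [condExp_of_stronglyMeasurable hG (stronglyMeasurable_const.indicator hA)
        ((integrable_const 1).indicator hA')] at h2
      filter_upwards [h2] with ω hω hωA
      simpa [hωA] using hω.symm
  have hsm : ∀ Q : Ω → EReal, Measurable[G] Q → MeasurableSet {ω | (X ω : EReal) ≤ Q ω} :=
    fun Q hQ => measurableSet_le hX.coe_real_ereal (hQ.mono hG le_rfl)
  have hall : ∀ Q : Ω → EReal, Measurable[G] Q →
      ((μ⟦{ω | (X ω : EReal) ≤ Q ω}|G⟧ =ᵐ[μ] fun _ => 1) ↔ ∀ᵐ ω ∂μ, (X ω : EReal) ≤ Q ω) := by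
    intro Q hQ
    have := key _ (hsm Q hQ) Set.univ MeasurableSet.univ
    simpa [Filter.EventuallyEq] using this
  let p : ℚ → Ω → ℝ := fun q => μ⟦{ω | X ω ≤ q}|G⟧
  have hpm : ∀ q, MeasurableSet[G] {ω | p q ω = 1} := fun q =>
    (stronglyMeasurable_condExp.measurable : Measurable[G] (p q)) (measurableSet_singleton 1)
  have hXq : ∀ q : ℚ, MeasurableSet {ω | X ω ≤ q} := fun q => measurableSet_le hX measurable_const
  classical
  have hmeas : Measurable[G] fun ω => ⨅ q : ℚ, if p q ω = 1 then ((q : ℝ) : EReal) else ⊤ :=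
    Measurable.iInf fun q => Measurable.ite (hpm q) measurable_const measurable_const
  refine ⟨fun ω => ⨅ q : ℚ, if p q ω = 1 then ((q : ℝ) : EReal) else ⊤, hmeas, ?_, ?_⟩
  · rw [hall _ hmeas]
    have h : ∀ q : ℚ, ∀ᵐ ω ∂μ, p q ω = 1 → X ω ≤ q := fun q =>
      (key _ (hXq q) _ (hpm q)).1 (Eventually.of_forall fun ω hω => hω)
    filter_upwards [ae_all_iff.2 h] with ω hω
    refine le_iInf fun q => ?_
    split_ifs with hq
    · exact EReal.coe_le_coe_iff.2 (hω q hq)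
    · exact le_top
  · intro Q hQ hQ1
    rw [hall Q hQ] at hQ1
    have h : ∀ q : ℚ, ∀ᵐ ω ∂μ, Q ω < ((q : ℝ) : EReal) → p q ω = 1 := fun q =>
      (key _ (hXq q) {ω | Q ω < ((q : ℝ) : EReal)} (hQ measurableSet_Iio)).2 (by
        filter_upwards [hQ1] with ω hω hq
        exact EReal.coe_le_coe_iff.1 (hω.trans hq.le))
    filter_upwards [ae_all_iff.2 h] with ω hω
    refine le_of_forall_gt_imp_ge_of_dense fun c hc => ?_
    obtain ⟨q, hq1, hq2⟩ := EReal.lt_iff_exists_rat_btwn.1 hc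
    refine (iInf_le _ q).trans ?_
    rw [if_pos (hω q hq1)]
    exact hq2.le

/-- The order statistic `x_{k:n}`, i.e. the `k`-th smallest of the first `n` terms of `x`, for
`1 ≤ k ≤ n` (and `0`, a value that is never used, for other `k`). -/
noncomputable def orderStat (x : ℕ → ℝ) (k n : ℕ) : ℝ :=
  if h : 1 ≤ k ∧ k ≤ n then
    (fun i : Fin n => x i) (Tuple.sort (fun i : Fin n => x i) ⟨k - 1, by omega⟩)
  else 0

/-- The number `K(k, n, a)` of those among the first `n` terms of `x` that lie in the open interval
`(x_{k:n} - a, x_{k:n})`. -/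
noncomputable def nearCount (x : ℕ → ℝ) (k n : ℕ) (a : ℝ) : ℝ :=
  ∑ i ∈ Finset.range n, (Set.Ioo (orderStat x k n - a) (orderStat x k n)).indicator 1 (x i)

/-- The variable `𝒦_t(k_{N(t)}, a)`, where `N` is the value `N(t)` of the counting process. -/
noncomputable def randomNearCount {Ω : Type*} (X : ℕ → Ω → ℝ) (k : ℕ → ℕ) (N : Ω → ℕ) (a : ℝ)
    (ω : Ω) : ℝ :=
  nearCount (fun i => X i ω) (k (N ω)) (N ω) a

/-- `I(γ < ∞) · P(X > γ - a | G)`. -/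
noncomputable def limitVariable {Ω : Type*} [m0 : MeasurableSpace Ω] (μ : Measure Ω)
    (G : MeasurableSpace Ω) (X : Ω → ℝ) (γ : Ω → EReal) (a : ℝ) (ω : Ω) : ℝ :=
  {ω' | γ ω' < ⊤}.indicator (fun _ => (1 : ℝ)) ω *
    (μ⟦{ω' | γ ω' - (a : EReal) < (X ω' : EReal)}|G⟧) ω

/-- `N(t) → ∞` in probability. -/
def TendstoInftyInProbability {Ω : Type*} [MeasurableSpace Ω] (μ : Measure Ω)
    (N : ℝ≥0 → Ω → ℕ) : Prop :=
  ∀ D : ℝ, Tendsto (fun t => μ {ω | (N t ω : ℝ) ≤ D}) atTop (𝓝 0)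

end NearMax

/-!
Apply Birkhoff's theorem on the space of real sequences: for a threshold `L` measurable with respect
to the invariant sigma-field, the proportion of the `X i` exceeding `L` tends to `P(X₁ > L | I)`.
If `L < γ`, minimality of `γ` makes this limit positive, so, since `k n / n → 1`, the order
statistic eventually exceeds `L`, while it never exceeds `γ`. The near-count frequency is therefore
squeezed between the frequency of exceeding `γ - a` minus that of exceeding `L`, and the frequency
of exceeding `L - a`. Letting `L` increase to `γ`, both bounds tend to `P(X₁ > γ - a | I)`, because
`X₁` charges neither `γ` nor `γ - a`. No case distinction is needed on `{γ = ∞}`: there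
`γ - a = ∞` and the limit is `0`.

Along a random index tending to infinity almost surely the limit is preserved by composition; if the
index tends to infinity only in probability, Egorov's theorem makes the convergence uniform off a
set of small measure.
-/

namespace NearMax

open scoped Finset

section Birkhoff

variable {α : Type*}

theorem partialSups_birkhoffSum_le (T : α → α) (f : α → ℝ) (n : ℕ) (x : α) :
    partialSups (birkhoffSum T f) n x ≤ max 0 (f x + partialSups (birkhoffSum T f) n (T x)) := by
  simp only [Pi.partialSups_apply]
  refine partialSups_le _ _ _ fun j hj => ?_
  cases j with
  | zero => exact le_max_of_le_left (birkhoffSum_zero T f x).le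
  | succ j =>
    rw [birkhoffSum_succ']
    exact le_max_of_le_right (add_le_add_right
      (le_partialSups_of_le (fun i => birkhoffSum T f i (T x)) (j.le_succ.trans hj)) _)

variable [MeasurableSpace α] {μ : Measure α} {T : α → α} {f : α → ℝ}

theorem integrable_birkhoffSum (hT : MeasurePreserving T μ μ) (hf : Integrable f μ) (n : ℕ) :
    Integrable (birkhoffSum T f n) μ :=
  integrable_finsetSum _ fun i _ => (hT.iterate i).integrable_comp_of_integrable hf

theorem integrable_partialSups {f : ℕ → α → ℝ} (hf : ∀ n, Integrable (f n) μ) (n : ℕ) :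
    Integrable (partialSups f n) μ := by
  induction n with
  | zero => simpa only [partialSups_zero] using hf 0
  | succ n ih => simpa only [← Order.succ_eq_add_one, partialSups_succ] using ih.sup (hf (n + 1))

theorem setIntegral_partialSups_birkhoffSum_pos_nonneg (hT : MeasurePreserving T μ μ)
    (hf : Integrable f μ) (n : ℕ) :
    0 ≤ ∫ x in {x | 0 < partialSups (birkhoffSum T f) n x}, f x ∂μ := by
  -- Garsia's argument: `M - M ∘ T ≤ f` where `M > 0`, and `M`, `M ∘ T` have the same integral.
  set M := partialSups (birkhoffSum T f) n
  have hM : Integrable M μ := integrable_partialSups (integrable_birkhoffSum hT hf) n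
  have hM_nonneg : ∀ x, 0 ≤ M x := fun x =>
    le_partialSups_of_le (birkhoffSum T f) (Nat.zero_le n) x
  have hpos : NullMeasurableSet {x | 0 < M x} μ :=
    nullMeasurableSet_lt aemeasurable_const hM.aemeasurable
  have hMT : Integrable (M ∘ T) μ := hT.integrable_comp_of_integrable hM
  have hle : ∀ x, M x - M (T x) ≤ {x | 0 < M x}.indicator f x := fun x => by
    by_cases hx : 0 < M x
    · rw [Set.indicator_of_mem (by exact hx)]
      have := (le_max_iff.1 (partialSups_birkhoffSum_le T f n x)).resolve_left hx.not_ge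
      linarith
    · rw [Set.indicator_of_notMem (by exact hx)]
      linarith [hM_nonneg (T x)]
  have hMT_eq : ∫ x, (M ∘ T) x ∂μ = ∫ x, M x ∂μ := by
    conv_rhs => rw [← hT.map_eq]
    exact (integral_map hT.aemeasurable (hT.map_eq.symm ▸ hM.aestronglyMeasurable)).symm
  calc 0 = ∫ x, M x - (M ∘ T) x ∂μ := by rw [integral_sub hM hMT, hMT_eq, sub_self]
    _ ≤ ∫ x, {x | 0 < M x}.indicator f x ∂μ :=
        integral_mono (hM.sub hMT) (hf.indicator₀ hpos) hle
    _ = ∫ x in {x | 0 < M x}, f x ∂μ := integral_indicator₀ hpos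

theorem setIntegral_birkhoffSum_pos_nonneg (hT : MeasurePreserving T μ μ) (hf : Integrable f μ) :
    0 ≤ ∫ x in {x | ∃ n, 0 < birkhoffSum T f n x}, f x ∂μ := by
  have hunion : {x | ∃ n, 0 < birkhoffSum T f n x} =
      ⋃ n, {x | 0 < partialSups (birkhoffSum T f) n x} := by
    ext x
    simp only [Set.mem_ofPred_eq, Set.mem_iUnion]
    refine ⟨fun ⟨n, hn⟩ => ⟨n, hn.trans_le (le_partialSups (birkhoffSum T f) n x)⟩, ?_⟩
    rintro ⟨n, hn⟩
    by_contra! hle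
    rw [Pi.partialSups_apply] at hn
    exact hn.not_ge (partialSups_le _ _ _ fun j _ => hle j)
  rw [hunion]
  refine ge_of_tendsto' (tendsto_setIntegral_of_monotone₀ (fun n => ?_) (fun m n hmn x hx => ?_)
    hf.integrableOn) (setIntegral_partialSups_birkhoffSum_pos_nonneg hT hf)
  · exact nullMeasurableSet_lt aemeasurable_const
      (integrable_partialSups (integrable_birkhoffSum hT hf) n).aemeasurable
  · exact lt_of_lt_of_le hx (partialSups_monotone (birkhoffSum T f) hmn x)

theorem measurableSet_invariants_bddAbove_birkhoffSum (hT : Measurable T) (hf : Measurable f) :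
    MeasurableSet[MeasurableSpace.invariants T]
      {x | BddAbove (Set.range fun n => birkhoffSum T f n x)} := by
  refine ⟨measurableSet_bddAbove_range fun n =>
    Finset.measurable_sum _ fun i _ => hf.comp (hT.iterate i), ?_⟩
  ext x
  simp only [Set.mem_preimage, Set.mem_ofPred_eq, bddAbove_def, Set.forall_mem_range]
  constructor
  · rintro ⟨M, hM⟩
    refine ⟨max 0 (f x + M), fun n => ?_⟩
    cases n with
    | zero => simp
    | succ n =>
      rw [birkhoffSum_succ']
      exact le_max_of_le_right (add_le_add_right (hM n) _)
  · rintro ⟨M, hM⟩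
    refine ⟨M - f x, fun n => ?_⟩
    have := hM (n + 1)
    rw [birkhoffSum_succ'] at this
    linarith

theorem ae_notMem_of_setIntegral_nonneg {s : Set α} (hs : MeasurableSet s)
    (hf : IntegrableOn f s μ) (hneg : ∀ᵐ x ∂μ, f x < 0) (hint : 0 ≤ ∫ x in s, f x ∂μ) :
    ∀ᵐ x ∂μ, x ∉ s := by
  have hneg_on : ∀ᵐ x ∂μ.restrict s, f x < 0 := ae_restrict_of_ae hneg
  have hpos_on : 0 ≤ᵐ[μ.restrict s] -f := hneg_on.mono fun x hx => neg_nonneg.2 hx.le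
  have hint_zero : ∫ x in s, (-f) x ∂μ = 0 := by
    refine le_antisymm ?_ (integral_nonneg_of_ae hpos_on)
    simpa only [Pi.neg_apply, integral_neg, neg_nonpos] using hint
  have hzero := (setIntegral_eq_zero_iff_of_nonneg_ae hpos_on hf.neg).1 hint_zero
  refine (ae_restrict_iff' hs).1 ?_
  filter_upwards [hneg_on, hzero] with x hx hx0
  exact hx.ne (neg_eq_zero.1 hx0)

theorem ae_bddAbove_birkhoffSum [IsFiniteMeasure μ] (hT : MeasurePreserving T μ μ)
    (hfm : Measurable f) (hf : Integrable f μ)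
    (hneg : ∀ᵐ x ∂μ, (μ[f | MeasurableSpace.invariants T]) x < 0) :
    ∀ᵐ x ∂μ, BddAbove (Set.range fun n => birkhoffSum T f n x) := by
  -- The set `A` where the sums are unbounded is invariant, so the maximal inequality on it gives
  -- `0 ≤ ∫ x in A, (μ[f | invariants T]) x ∂μ`, contradicting `hneg` unless `A` is null.
  set A : Set α := {x | BddAbove (Set.range fun n => birkhoffSum T f n x)}ᶜ
  have hA : MeasurableSet[MeasurableSpace.invariants T] A :=
    (measurableSet_invariants_bddAbove_birkhoffSum hT.measurable hfm).compl
  have hTA : MeasurePreserving T (μ.restrict A) (μ.restrict A) := by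
    simpa only [hA.2] using hT.restrict_preimage hA.1
  have hexists : {x | ∃ n, 0 < birkhoffSum T f n x} =ᵐ[μ.restrict A] Set.univ := by
    refine eventuallyEq_univ.2 ((ae_restrict_iff' hA.1).2 (Eventually.of_forall fun x hx => ?_))
    simpa using (not_bddAbove_iff.1 hx) 0
  have hnonneg : 0 ≤ ∫ x in A, (μ[f | MeasurableSpace.invariants T]) x ∂μ := by
    rw [setIntegral_condExp (MeasurableSpace.invariants_le T) hf hA]
    have h := setIntegral_birkhoffSum_pos_nonneg hTA hf.integrableOn
    rwa [setIntegral_congr_set hexists, setIntegral_univ] at h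
  exact (ae_notMem_of_setIntegral_nonneg hA.1 integrable_condExp.integrableOn hneg hnonneg).mono
    fun x hx => not_not.1 hx

theorem ae_eventually_birkhoffAverage_lt [IsFiniteMeasure μ] (hT : MeasurePreserving T μ μ)
    (hfm : Measurable f) (hf : Integrable f μ) {ε : ℝ} (hε : 0 < ε) :
    ∀ᵐ x ∂μ, ∀ᶠ n in atTop,
      birkhoffAverage ℝ T f n x < (μ[f | MeasurableSpace.invariants T]) x + ε := by
  have hm := MeasurableSpace.invariants_le T
  set p := μ[f | MeasurableSpace.invariants T]
  have hpm : Measurable[MeasurableSpace.invariants T] p := stronglyMeasurable_condExp.measurable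
  set g : α → ℝ := p + fun _ => ε / 2
  have hg : Measurable[MeasurableSpace.invariants T] g := hpm.add_const _
  have hgi : Integrable g μ := integrable_condExp.add (integrable_const _)
  have hdrift : μ[f - g | MeasurableSpace.invariants T] =ᵐ[μ] fun _ => -(ε / 2) := by
    filter_upwards [condExp_sub hf hgi (MeasurableSpace.invariants T)] with x hx
    rw [hx, condExp_of_stronglyMeasurable hm hg.stronglyMeasurable hgi]
    simp [g, p]
  have hbdd := ae_bddAbove_birkhoffSum hT (hfm.sub (hg.mono hm le_rfl)) (hf.sub hgi)
    (hdrift.mono fun x hx => by rw [hx]; linarith)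
  filter_upwards [hbdd] with x ⟨M, hM⟩
  have hlim : Tendsto (fun n : ℕ => M / n) atTop (𝓝 0) := tendsto_const_div_atTop_nhds_zero_nat M
  filter_upwards [hlim.eventually_lt_const (half_pos hε), eventually_gt_atTop 0] with n hn hn0
  have hn0 : (0 : ℝ) < n := Nat.cast_pos.2 hn0
  have hsum : birkhoffSum T f n x - n * (p x + ε / 2) ≤ M := by
    have : birkhoffSum T (f - g) n x ≤ M := hM ⟨n, rfl⟩
    rwa [birkhoffSum_sub,
      birkhoffSum_of_comp_eq (MeasurableSpace.comp_eq_of_measurable_invariants hg), Pi.smul_apply,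
      nsmul_eq_mul] at this
  rw [birkhoffAverage, smul_eq_mul, inv_mul_lt_iff₀ hn0]
  rw [div_lt_iff₀ hn0] at hn
  linarith

theorem ae_tendsto_birkhoffAverage [IsFiniteMeasure μ] (hT : MeasurePreserving T μ μ)
    (hf : Integrable f μ) :
    ∀ᵐ x ∂μ, Tendsto (fun n => birkhoffAverage ℝ T f n x) atTop
      (𝓝 ((μ[f | MeasurableSpace.invariants T]) x)) := by
  wlog hfm : Measurable f generalizing f
  · have hmk := hf.aemeasurable.ae_eq_mk
    filter_upwards [this (hf.congr hmk) hf.aemeasurable.measurable_mk,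
      condExp_congr_ae (m := MeasurableSpace.invariants T) hmk,
      ae_all_iff.2 fun n => hT.quasiMeasurePreserving.birkhoffAverage_ae_eq_of_ae_eq ℝ hmk n]
      with x hx hcond havg
    rw [hcond]
    exact hx.congr fun n => (havg n).symm
  have hrat : ∀ n : ℕ, (0 : ℝ) < 1 / (n + 1) := fun n => Nat.one_div_pos_of_nat
  filter_upwards [ae_all_iff.2 fun m => ae_eventually_birkhoffAverage_lt hT hfm hf (hrat m),
    ae_all_iff.2 fun m => ae_eventually_birkhoffAverage_lt hT hfm.neg hf.neg (hrat m),
    condExp_neg f (MeasurableSpace.invariants T)] with x hupper hlower hneg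
  refine tendsto_order.2 ⟨fun b hb => ?_, fun b hb => ?_⟩
  · obtain ⟨m, hm⟩ := exists_nat_one_div_lt (sub_pos.2 hb)
    filter_upwards [hlower m] with n hn
    simp only [hneg, birkhoffAverage_neg, Pi.neg_apply] at hn
    linarith
  · obtain ⟨m, hm⟩ := exists_nat_one_div_lt (sub_pos.2 hb)
    filter_upwards [hupper m] with n hn
    linarith

end Birkhoff

section PathSpace

/-- The left shift of one-sided sequences. -/
def shift {β : Type*} (x : ℕ → β) : ℕ → β := fun j => x (j + 1)

/-- The sample path of a process. -/
def path {Ω β : Type*} (X : ℕ → Ω → β) (ω : Ω) : ℕ → β := fun j => X j ω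

theorem iterate_shift_apply {β : Type*} (n : ℕ) (x : ℕ → β) (j : ℕ) :
    shift^[n] x j = x (n + j) := by
  induction n generalizing x with
  | zero => simp
  | succ n ih =>
    rw [Function.iterate_succ_apply, ih]
    exact congrArg x (by omega)

theorem iterate_shift_path {Ω β : Type*} (X : ℕ → Ω → β) (n : ℕ) (ω : Ω) :
    shift^[n] (path X ω) = fun j => X (n + j) ω :=
  funext (iterate_shift_apply n (path X ω))

theorem measurable_shift {β : Type*} [MeasurableSpace β] : Measurable (shift (β := β)) :=
  measurable_pi_lambda _ fun j => measurable_pi_apply (j + 1)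

theorem measurable_path {Ω β : Type*} [MeasurableSpace Ω] [MeasurableSpace β] {X : ℕ → Ω → β}
    (hX : ∀ i, Measurable (X i)) : Measurable (path X) :=
  measurable_pi_lambda _ hX

theorem measurePreserving_shift {Ω : Type*} [MeasurableSpace Ω] {μ : Measure Ω}
    {X : ℕ → Ω → ℝ} (hX : ∀ i, Measurable (X i)) (hstat : StrictlyStationary μ X) :
    MeasurePreserving shift (μ.map (path X)) (μ.map (path X)) := by
  refine ⟨measurable_shift, ?_⟩
  rw [Measure.map_map measurable_shift (measurable_path hX)]
  have hmap := (hstat 1).map_eq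
  simp only [add_comm 1] at hmap
  exact hmap

theorem invariantSigma_eq_comap {Ω : Type*} (X : ℕ → Ω → ℝ) :
    invariantSigma X = (MeasurableSpace.invariants shift).comap (path X) := by
  ext A
  constructor
  · rintro ⟨B, hB, hA⟩
    have hpath : ∀ ω n, shift^[n] (path X ω) ∈ B ↔ ω ∈ A := fun ω n => by
      rw [iterate_shift_path, hA n, Set.mem_ofPred_eq]
    -- `B` need not be shift-invariant, but it may be replaced by the set of sequences whose shifts
    -- lie in `B` infinitely often.
    let C : Set (ℕ → ℝ) := limsup (fun n => (Set.preimage shift)^[n] B) atTop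
    have hC : MeasurableSet[MeasurableSpace.invariants shift] C := by
      refine ⟨MeasurableSet.measurableSet_limsup fun n => ?_,
        CompleteLatticeHom.apply_limsup_iterate (CompleteLatticeHom.setPreimage shift) B⟩
      rw [← Set.preimage_iterate_eq]
      exact measurable_shift.iterate n hB
    refine ⟨C, hC, ?_⟩
    ext ω
    simp only [C, Set.mem_preimage, ← Set.preimage_iterate_eq, mem_limsup_iff_frequently_mem, hpath,
      frequently_const]
  · rintro ⟨B, hB, rfl⟩
    refine ⟨B, hB.1, fun i => ?_⟩
    have hi : shift^[i] ⁻¹' B = B := by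
      rw [Set.preimage_iterate_eq]
      exact Function.iterate_fixed hB.2 i
    simp only [← iterate_shift_path]
    exact congrArg (path X ⁻¹' ·) hi.symm

theorem exists_eq_comp_path {Ω Z : Type*} [MeasurableSpace Z] [StandardBorelSpace Z] [Nonempty Z]
    {X : ℕ → Ω → ℝ} {L : Ω → Z} (hL : Measurable[invariantSigma X] L) :
    ∃ Λ : (ℕ → ℝ) → Z, Measurable Λ ∧ (∀ n x, Λ (shift^[n] x) = Λ x) ∧ L = Λ ∘ path X := by
  rw [invariantSigma_eq_comap] at hL
  obtain ⟨Λ, hΛ, rfl⟩ :=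
    @Measurable.exists_eq_measurable_comp _ _ _ (MeasurableSpace.invariants shift) _ _ _ _ _ hL
  refine ⟨Λ, hΛ.mono (MeasurableSpace.invariants_le shift) le_rfl, fun n x => ?_, rfl⟩
  exact congrFun (MeasurableSpace.comp_eq_of_measurable_invariants
    (hΛ.mono (MeasurableSpace.le_invariants_iterate shift n) le_rfl)) x

theorem condExp_comap_comp {α β E : Type*} {m' : MeasurableSpace β} [mα : MeasurableSpace α]
    [mβ : MeasurableSpace β] {μ : Measure α} {ν : Measure β} [IsFiniteMeasure μ]
    [IsFiniteMeasure ν] [NormedAddCommGroup E] [NormedSpace ℝ E] [CompleteSpace E] {f : α → β}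
    {g : β → E} (hf : MeasurePreserving f μ ν) (hm' : m' ≤ mβ) (hg : Integrable g ν) :
    μ[g ∘ f | m'.comap f] =ᵐ[μ] ν[g | m'] ∘ f := by
  have hle : m'.comap f ≤ mα := (MeasurableSpace.comap_mono hm').trans hf.measurable.comap_le
  have hint : Integrable (ν[g | m'] ∘ f) μ := hf.integrable_comp_of_integrable integrable_condExp
  refine (ae_eq_condExp_of_forall_setIntegral_eq hle (hf.integrable_comp_of_integrable hg)
    (fun _ _ _ => hint.integrableOn) ?_ ?_).symm
  · rintro _ ⟨s, hs, rfl⟩ -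
    have hset : ∀ h : β → E, AEStronglyMeasurable h ν →
        ∫ x in f ⁻¹' s, h (f x) ∂μ = ∫ y in s, h y ∂ν := fun h hh => by
      rw [← hf.map_eq] at hh ⊢
      exact (setIntegral_map (hm' s hs) hh hf.aemeasurable).symm
    simp only [Function.comp_apply]
    rw [hset _ integrable_condExp.aestronglyMeasurable, hset _ hg.aestronglyMeasurable,
      setIntegral_condExp hm' hg hs]
  · exact (stronglyMeasurable_condExp.comp_measurable (comap_measurable f)).aestronglyMeasurable

end PathSpace

section Frequency

/-- The proportion of those among the first `n` terms of `x` that exceed `c`. -/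
noncomputable def exceedFreq (x : ℕ → ℝ) (c : EReal) (n : ℕ) : ℝ :=
  #{i ∈ Finset.range n | c < x i} / n

variable {Ω : Type*} [MeasurableSpace Ω] {μ : Measure Ω} {X : ℕ → Ω → ℝ}

theorem ae_tendsto_exceedFreq [IsFiniteMeasure μ] (hX : ∀ i, Measurable (X i))
    (hstat : StrictlyStationary μ X) {L : Ω → EReal} (hL : Measurable[invariantSigma X] L) :
    ∀ᵐ ω ∂μ, Tendsto (exceedFreq (path X ω) (L ω)) atTop
      (𝓝 ((μ⟦{ω | L ω < X 0 ω} | invariantSigma X⟧) ω)) := by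
  obtain ⟨Λ, hΛ, hΛshift, rfl⟩ := exists_eq_comp_path hL
  have hpath : MeasurePreserving (path X) μ (μ.map (path X)) :=
    (measurable_path hX).measurePreserving μ
  set f : (ℕ → ℝ) → ℝ := {x | Λ x < x 0}.indicator fun _ => 1
  have hf : Integrable f (μ.map (path X)) := (integrable_const 1).indicator
    (measurableSet_lt hΛ (measurable_pi_apply 0).coe_real_ereal)
  have havg : ∀ x n, birkhoffAverage ℝ shift f n x = exceedFreq x (Λ x) n := fun x n => by
    rw [birkhoffAverage, birkhoffSum, exceedFreq, smul_eq_mul, inv_mul_eq_div]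
    simp only [f, Set.indicator_apply, Set.mem_ofPred_eq, hΛshift, iterate_shift_apply, add_zero,
      Finset.sum_boole]
  rw [invariantSigma_eq_comap]
  filter_upwards [hpath.quasiMeasurePreserving.ae
    (ae_tendsto_birkhoffAverage (measurePreserving_shift hX hstat) hf),
    condExp_comap_comp hpath (MeasurableSpace.invariants_le shift) hf] with ω hω hcond
  simp only [havg, ← Function.comp_apply (f := condExp _ _ f), ← hcond] at hω
  exact hω

theorem ae_forall_le (hX : ∀ i, Measurable (X i)) (hstat : StrictlyStationary μ X)
    {Q : Ω → EReal} (hQ : Measurable[invariantSigma X] Q) (hle : ∀ᵐ ω ∂μ, X 0 ω ≤ Q ω) :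
    ∀ᵐ ω ∂μ, ∀ i, X i ω ≤ Q ω := by
  obtain ⟨Λ, hΛ, hΛshift, rfl⟩ := exists_eq_comp_path hQ
  have hpath := (measurable_path hX).aemeasurable (μ := μ)
  have hle_path : ∀ᵐ x ∂μ.map (path X), (x 0 : EReal) ≤ Λ x :=
    (ae_map_iff hpath (measurableSet_le (measurable_pi_apply 0).coe_real_ereal hΛ)).2 hle
  refine ae_all_iff.2 fun i => ?_
  filter_upwards [ae_of_ae_map hpath
    (((measurePreserving_shift hX hstat).iterate i).quasiMeasurePreserving.ae hle_path)] with ω hω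
  rw [hΛshift, iterate_shift_apply] at hω
  exact hω

end Frequency

section CondProb

variable {Ω : Type*} {m : MeasurableSpace Ω} [m0 : MeasurableSpace Ω] {μ : Measure Ω}
  [IsFiniteMeasure μ] {s : Set Ω}

theorem ae_notMem_of_condProb_eq_zero (hm : m ≤ m0) (hs : MeasurableSet s) :
    ∀ᵐ ω ∂μ, (μ⟦s | m⟧) ω = 0 → ω ∉ s := by
  set A : Set Ω := {ω | (μ⟦s | m⟧) ω = 0}
  have hA : MeasurableSet[m] A :=
    stronglyMeasurable_condExp.measurable (measurableSet_singleton 0)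
  have hint : Integrable (s.indicator fun _ => (1 : ℝ)) μ := (integrable_const 1).indicator hs
  have hzero : ∫ ω in A, s.indicator (fun _ => (1 : ℝ)) ω ∂μ = 0 := by
    rw [← setIntegral_condExp hm hint hA]
    exact setIntegral_eq_zero_of_forall_eq_zero fun ω hω => hω
  rw [setIntegral_indicator hs, setIntegral_const, smul_eq_mul, mul_one,
    measureReal_eq_zero_iff] at hzero
  filter_upwards [measure_eq_zero_iff_ae_notMem.1 hzero] with ω hω hωA hωs
  exact hω ⟨hωA, hωs⟩

theorem condProb_compl (hm : m ≤ m0) (hs : MeasurableSet s) :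
    μ⟦sᶜ | m⟧ =ᵐ[μ] fun ω => 1 - (μ⟦s | m⟧) ω := by
  have hone : (sᶜ.indicator fun _ => (1 : ℝ)) = (fun _ => 1) - s.indicator fun _ => 1 :=
    Set.indicator_compl s _
  rw [hone]
  filter_upwards [condExp_sub (integrable_const (1 : ℝ)) ((integrable_const 1).indicator hs) m]
    with ω hω
  rw [hω, Pi.sub_apply, condExp_const hm]

theorem condProb_eq_one_iff (hm : m ≤ m0) (hs : MeasurableSet s) :
    μ⟦s | m⟧ =ᵐ[μ] (fun _ => 1) ↔ ∀ᵐ ω ∂μ, ω ∈ s := by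
  constructor
  · intro h
    filter_upwards [h, condProb_compl hm hs, ae_notMem_of_condProb_eq_zero hm hs.compl]
      with ω hω hcompl hnot
    exact Set.notMem_compl_iff.1 (hnot (by rw [hcompl, hω, sub_self]))
  · intro h
    have hind : (s.indicator fun _ => (1 : ℝ)) =ᵐ[μ] fun _ => 1 :=
      h.mono fun ω hω => Set.indicator_of_mem hω _
    filter_upwards [condExp_congr_ae (m := m) hind] with ω hω
    rw [hω, condExp_const hm]

theorem ae_tendsto_condProb_iInter (hm : m ≤ m0) {s : ℕ → Set Ω} (hs : ∀ n, MeasurableSet (s n))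
    (hanti : Antitone s) :
    ∀ᵐ ω ∂μ, Tendsto (fun n => (μ⟦s n | m⟧) ω) atTop (𝓝 ((μ⟦⋂ n, s n | m⟧) ω)) := by
  have hint : ∀ {t : Set Ω}, MeasurableSet t → Integrable (t.indicator fun _ => (1 : ℝ)) μ :=
    fun ht => (integrable_const 1).indicator ht
  have hinter : MeasurableSet (⋂ n, s n) := MeasurableSet.iInter hs
  have hmono : ∀ {t u : Set Ω}, MeasurableSet t → MeasurableSet u → t ⊆ u →
      μ⟦t | m⟧ ≤ᵐ[μ] μ⟦u | m⟧ := fun ht hu htu =>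
    condExp_mono (hint ht) (hint hu) (Eventually.of_forall
      (Set.indicator_le_indicator_of_subset htu fun _ => zero_le_one))
  refine tendsto_of_integral_tendsto_of_antitone (fun n => integrable_condExp)
    integrable_condExp ?_ ?_ ?_
  · simp only [integral_condExp hm, integral_indicator_const _ (hs _),
      integral_indicator_const _ hinter]
    refine Tendsto.smul_const ?_ _
    exact (ENNReal.tendsto_toReal (measure_ne_top μ _)).comp (tendsto_measure_iInter_atTop
      (fun n => (hs n).nullMeasurableSet) hanti ⟨0, measure_ne_top μ _⟩)
  · have hsucc : ∀ n, μ⟦s (n + 1) | m⟧ ≤ᵐ[μ] μ⟦s n | m⟧ := fun n =>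
      hmono (hs _) (hs _) (hanti n.le_succ)
    filter_upwards [ae_all_iff.2 hsucc] with ω hω
    exact antitone_nat_of_succ_le hω
  · exact ae_all_iff.2 fun n => hmono hinter (hs n) (Set.iInter_subset s n)

end CondProb

section Endpoint

/-- A sequence that strictly increases to `c` when `c ≠ ⊥`, whether `c` is real or `⊤`. -/
noncomputable def lowerApprox (c : EReal) (n : ℕ) : EReal :=
  min c n - ((n + 1 : ℝ)⁻¹ : ℝ)

theorem lowerApprox_mono (c : EReal) : Monotone (lowerApprox c) := by
  intro m n hmn
  have hmn' : (m : ℝ) ≤ n := Nat.cast_le.2 hmn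
  refine EReal.sub_le_sub (min_le_min le_rfl (by exact_mod_cast hmn)) (EReal.coe_le_coe_iff.2 ?_)
  gcongr

theorem measurable_sub_coe (b : ℝ) : Measurable fun c : EReal => c - b := by
  simp only [sub_eq_add_neg]
  exact measurable_id.add measurable_const

theorem measurable_lowerApprox (n : ℕ) : Measurable fun c => lowerApprox c n :=
  (measurable_sub_coe _).comp (measurable_id.min measurable_const)

theorem lowerApprox_lt {c : EReal} (hc : c ≠ ⊥) (n : ℕ) : lowerApprox c n < c := by
  have hreal : min c n ≠ ⊤ ∧ min c n ≠ ⊥ :=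
    ⟨ne_top_of_le_ne_top (EReal.natCast_ne_top n) (min_le_right c n),
      (lt_min hc.bot_lt (EReal.bot_lt_coe n)).ne'⟩
  refine lt_of_lt_of_le ?_ (min_le_left c n)
  rw [lowerApprox]
  lift min c n to ℝ using hreal with r
  rw [← EReal.coe_sub, EReal.coe_lt_coe_iff]
  exact sub_lt_self r Nat.inv_pos_of_nat

theorem tendsto_sub_coe {ι : Type*} {l : Filter ι} {u : ι → EReal} {v : ι → ℝ} {c : EReal} {b : ℝ}
    (hu : Tendsto u l (𝓝 c)) (hv : Tendsto v l (𝓝 b)) :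
    Tendsto (fun i => u i - v i) l (𝓝 (c - b)) := by
  simp only [sub_eq_add_neg, ← EReal.coe_neg]
  have hadd := EReal.continuousAt_add (p := (c, ((-b : ℝ) : EReal)))
    (Or.inr (EReal.coe_ne_bot _)) (Or.inr (EReal.coe_ne_top _))
  exact hadd.tendsto.comp (hu.prodMk_nhds (EReal.tendsto_coe.2 hv.neg))

theorem tendsto_lowerApprox (c : EReal) : Tendsto (lowerApprox c) atTop (𝓝 c) := by
  have hnat : Tendsto (fun n : ℕ => (n : EReal)) atTop (𝓝 ⊤) :=
    EReal.tendsto_coe_nhds_top_iff.2 tendsto_natCast_atTop_atTop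
  have hmin : Tendsto (fun n : ℕ => min c (n : EReal)) atTop (𝓝 c) := by
    simpa only [min_eq_left le_top] using tendsto_const_nhds.min hnat
  have hinv : Tendsto (fun n : ℕ => (n + 1 : ℝ)⁻¹) atTop (𝓝 0) := by
    simpa only [one_div] using tendsto_one_div_add_atTop_nhds_zero_nat (𝕜 := ℝ)
  have hsub := tendsto_sub_coe hmin hinv
  rwa [EReal.coe_zero, sub_zero] at hsub

theorem forall_lowerApprox_sub_lt_iff {c : EReal} {b y : ℝ} :
    (∀ n, lowerApprox c n - b < y) ↔ c - b ≤ y := by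
  constructor
  · intro h
    exact le_of_tendsto' (tendsto_sub_coe (tendsto_lowerApprox c) tendsto_const_nhds)
      fun n => (h n).le
  · intro h n
    rcases eq_or_ne c ⊥ with rfl | hc
    · simp [lowerApprox]
    · exact (EReal.sub_lt_sub_of_lt_of_le (lowerApprox_lt hc n) le_rfl (EReal.coe_ne_bot b)
        (EReal.coe_ne_top b)).trans_le h

variable {Ω : Type*} {G : MeasurableSpace Ω} [m0 : MeasurableSpace Ω] {μ : Measure Ω}
  {X : Ω → ℝ} {γ : Ω → EReal}

theorem IsCondRightEndpoint.ae_le [IsFiniteMeasure μ] (hγ : IsCondRightEndpoint μ G X γ)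
    (hG : G ≤ m0) (hX : Measurable X) : ∀ᵐ ω ∂μ, X ω ≤ γ ω :=
  (condProb_eq_one_iff hG
    (measurableSet_le hX.coe_real_ereal (hγ.measurable.mono hG le_rfl))).1 hγ.condProb_le

theorem IsCondRightEndpoint.condProb_pos_of_lt [IsFiniteMeasure μ]
    (hγ : IsCondRightEndpoint μ G X γ) (hG : G ≤ m0) (hX : Measurable X) {L : Ω → EReal}
    (hL : Measurable[G] L) : ∀ᵐ ω ∂μ, L ω < γ ω → 0 < (μ⟦{ω | L ω < X ω} | G⟧) ω := by
  classical
  set p := μ⟦{ω | L ω < X ω} | G⟧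
  have hexceed : MeasurableSet {ω | L ω < X ω} :=
    measurableSet_lt (hL.mono hG le_rfl) hX.coe_real_ereal
  have hp : MeasurableSet[G] {ω | p ω = 0} :=
    stronglyMeasurable_condExp.measurable (measurableSet_singleton 0)
  -- Where `p = 0` the endpoint could be lowered to `L`, against minimality unless `γ ≤ L` there.
  let Q : Ω → EReal := fun ω => if p ω = 0 then L ω else γ ω
  have hQ : Measurable[G] Q := Measurable.ite hp hL hγ.measurable
  have hXQ : ∀ᵐ ω ∂μ, X ω ≤ Q ω := by
    filter_upwards [hγ.ae_le hG hX, ae_notMem_of_condProb_eq_zero hG hexceed] with ω hγω hLω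
    by_cases hω : p ω = 0
    · exact (not_lt.1 (hLω hω)).trans_eq (if_pos hω).symm
    · exact hγω.trans_eq (if_neg hω).symm
  have hp_nonneg : 0 ≤ᵐ[μ] p :=
    condExp_nonneg (Eventually.of_forall (Set.indicator_nonneg fun _ _ => zero_le_one))
  filter_upwards [hγ.minimal Q hQ ((condProb_eq_one_iff hG (measurableSet_le hX.coe_real_ereal
    (hQ.mono hG le_rfl))).2 hXQ), hp_nonneg] with ω hmin hω hlt
  refine hω.lt_of_ne' fun hzero => hlt.not_ge ?_
  exact hmin.trans_eq (if_pos hzero)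

theorem condProb_congr_ae {s t : Set Ω} (h : s =ᵐ[μ] t) : μ⟦s | G⟧ =ᵐ[μ] μ⟦t | G⟧ :=
  condExp_congr_ae (indicator_ae_eq_of_ae_eq_set h)

theorem limitVariable_ae_eq [IsFiniteMeasure μ] (hG : G ≤ m0) (hX : Measurable X)
    (hγ : Measurable[G] γ) (a : ℝ) :
    limitVariable μ G X γ a =ᵐ[μ] μ⟦{ω | γ ω - a < X ω} | G⟧ := by
  have hint : Integrable ({ω | γ ω - a < X ω}.indicator fun _ => (1 : ℝ)) μ :=
    (integrable_const 1).indicator (measurableSet_lt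
      ((measurable_sub_coe a).comp (hγ.mono hG le_rfl)) hX.coe_real_ereal)
  have hsub : {ω | γ ω - a < X ω} ⊆ {ω | γ ω < ⊤} := fun ω hω => by
    refine (lt_top_iff_ne_top (a := γ ω)).2 fun htop => ?_
    rw [Set.mem_ofPred_eq, htop, EReal.top_sub_coe] at hω
    exact not_top_lt hω
  have hfin : MeasurableSet[G] {ω | γ ω < ⊤} := hγ measurableSet_Iio
  have hind := condExp_indicator hint hfin
  rw [Set.indicator_indicator, Set.inter_eq_right.2 hsub] at hind
  filter_upwards [hind] with ω hω
  rw [hω, limitVariable, ← Set.indicator_mul_left]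
  simp only [one_mul]

theorem ae_tendsto_condProb_lowerApprox [IsFiniteMeasure μ] (hG : G ≤ m0) (hX : Measurable X)
    (hγ : Measurable γ) {b : ℝ} (hb : μ {ω | (X ω : EReal) = γ ω - b} = 0) :
    ∀ᵐ ω ∂μ, Tendsto (fun n => (μ⟦{ω | lowerApprox (γ ω) n - b < X ω} | G⟧) ω) atTop
      (𝓝 ((μ⟦{ω | γ ω - b < X ω} | G⟧) ω)) := by
  have hmeas : ∀ n, MeasurableSet {ω | lowerApprox (γ ω) n - b < X ω} := fun n =>
    measurableSet_lt ((measurable_sub_coe b).comp ((measurable_lowerApprox n).comp hγ))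
      hX.coe_real_ereal
  have hanti : Antitone fun n => {ω | lowerApprox (γ ω) n - b < X ω} := fun m n hmn ω hω =>
    (EReal.sub_le_sub (lowerApprox_mono (γ ω) hmn) le_rfl).trans_lt hω
  have hinter : (⋂ n, {ω | lowerApprox (γ ω) n - b < X ω}) =ᵐ[μ] {ω | γ ω - b < X ω} := by
    filter_upwards [measure_eq_zero_iff_ae_notMem.1 hb] with ω hω
    refine propext (Set.mem_iInter.trans (forall_lowerApprox_sub_lt_iff.trans ?_))
    exact ⟨fun h => h.lt_of_ne' hω, le_of_lt⟩
  filter_upwards [ae_tendsto_condProb_iInter hG hmeas hanti, condProb_congr_ae hinter]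
    with ω hω heq
  rwa [heq] at hω

theorem IsCondRightEndpoint.ae_tendsto_condProb_lowerApprox_zero [IsFiniteMeasure μ]
    (hγ : IsCondRightEndpoint μ G X γ) (hG : G ≤ m0) (hX : Measurable X)
    (hγ0 : μ {ω | (X ω : EReal) = γ ω} = 0) :
    ∀ᵐ ω ∂μ, Tendsto (fun n => (μ⟦{ω | lowerApprox (γ ω) n < X ω} | G⟧) ω) atTop (𝓝 0) := by
  have hempty : {ω | γ ω < X ω} =ᵐ[μ] (∅ : Set Ω) :=
    eventuallyEq_empty.2 ((hγ.ae_le hG hX).mono fun ω hω => hω.not_gt)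
  have hlim := ae_tendsto_condProb_lowerApprox hG hX (hγ.measurable.mono hG le_rfl) (b := 0)
    (by simpa only [EReal.coe_zero, sub_zero] using hγ0)
  filter_upwards [hlim, condProb_congr_ae (G := G) hempty] with ω hω hzero
  simpa only [EReal.coe_zero, sub_zero, hzero, Set.indicator_empty, condExp_fun_zero,
    Pi.zero_apply] using hω

end Endpoint

section OrderStatistics

variable {x : ℕ → ℝ} {k n : ℕ} {a : ℝ} {c L : EReal}

theorem orderStat_le_iff (hk : 1 ≤ k) (hkn : k ≤ n) :
    orderStat x k n ≤ c ↔ k ≤ #{i ∈ Finset.range n | (x i : EReal) ≤ c} := by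
  set σ := Tuple.sort fun i : Fin n => x i
  have hmono : Monotone fun i : Fin n => (x (σ i) : EReal) :=
    EReal.coe_strictMono.monotone.comp (Tuple.monotone_sort fun i : Fin n => x i)
  have hcard : #{i ∈ Finset.range n | (x i : EReal) ≤ c} = #{i : Fin n | (x (σ i) : EReal) ≤ c} :=
    calc #{i ∈ Finset.range n | (x i : EReal) ≤ c}
      _ = #{i : Fin n | (x i : EReal) ≤ c} := by
        simp only [Finset.card_filter, Finset.sum_range]
      _ = #{i : Fin n | (x (σ i) : EReal) ≤ c} := (Finset.card_equiv σ fun i => by simp).symm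
  rw [orderStat, dif_pos ⟨hk, hkn⟩, hcard,
    ← Tuple.lt_card_le_iff_apply_le_of_monotone (a := c) (j := ⟨k - 1, by omega⟩) hmono]
  dsimp only
  omega

theorem orderStat_le (hk : 1 ≤ k) (hkn : k ≤ n) (hx : ∀ i, (x i : EReal) ≤ c) :
    orderStat x k n ≤ c := by
  rw [orderStat_le_iff hk hkn, Finset.filter_true_of_mem fun i _ => hx i, Finset.card_range]
  exact hkn

theorem nearCount_eq_card (x : ℕ → ℝ) (k n : ℕ) (a : ℝ) : nearCount x k n a =
    #{i ∈ Finset.range n | x i ∈ Set.Ioo (orderStat x k n - a) (orderStat x k n)} := by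
  classical
  simp only [nearCount, Set.indicator_apply, Pi.one_apply, Finset.sum_boole]

theorem nearCount_div_le (hL : L < orderStat x k n) :
    nearCount x k n a / n ≤ exceedFreq x (L - a) n := by
  rw [nearCount_eq_card, exceedFreq]
  gcongr with i
  rintro ⟨hi, -⟩
  exact (EReal.sub_le_sub hL.le le_rfl).trans_lt (EReal.coe_lt_coe_iff.2 hi)

theorem exceedFreq_sub_le (hc : orderStat x k n ≤ c) (hL : L < orderStat x k n) :
    exceedFreq x (c - a) n - exceedFreq x L n ≤ nearCount x k n a / n := by
  rw [nearCount_eq_card, exceedFreq, exceedFreq, ← sub_div]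
  gcongr
  rw [sub_le_iff_le_add, ← Nat.cast_add, Nat.cast_le]
  refine (Finset.card_le_card fun i hi => ?_).trans (Finset.card_union_le _ _)
  simp only [Finset.mem_filter, Finset.mem_union, ← and_or_left] at hi ⊢
  refine ⟨hi.1, or_iff_not_imp_right.2 fun hLi => ⟨?_, ?_⟩⟩
  · exact EReal.coe_lt_coe_iff.1 ((EReal.sub_le_sub hc le_rfl).trans_lt hi.2)
  · exact EReal.coe_lt_coe_iff.1 ((not_lt.1 hLi).trans_lt hL)

theorem eventually_lt_orderStat {k : ℕ → ℕ} (hk : ∀ n, 1 ≤ n → 1 ≤ k n ∧ k n ≤ n)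
    (hklim : Tendsto (fun n => (k n : ℝ) / (n : ℝ)) atTop (𝓝 1)) {p : ℝ} (hp : 0 < p)
    (hL : Tendsto (exceedFreq x L) atTop (𝓝 p)) :
    ∀ᶠ n in atTop, L < orderStat x (k n) n := by
  have hgt : ∀ᶠ n in atTop, 1 < (k n : ℝ) / n + exceedFreq x L n :=
    (hklim.add hL).eventually_const_lt (lt_add_of_pos_right 1 hp)
  filter_upwards [hgt, eventually_ge_atTop 1] with n hn hn1
  by_contra! hle
  have hkn := (orderStat_le_iff (hk n hn1).1 (hk n hn1).2).1 hle
  have hsplit := Finset.card_filter_add_card_filter_not (s := Finset.range n)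
    fun i => (x i : EReal) ≤ L
  refine hn.not_ge ?_
  rw [exceedFreq, ← add_div, div_le_one (by positivity), ← Nat.cast_add, Nat.cast_le]
  simp only [not_le, Finset.card_range] at hsplit
  omega

theorem tendsto_nearCount_div {k : ℕ → ℕ} (hk : ∀ n, 1 ≤ n → 1 ≤ k n ∧ k n ≤ n)
    (hklim : Tendsto (fun n => (k n : ℝ) / (n : ℝ)) atTop (𝓝 1)) (hc : ∀ i, x i ≤ c)
    {L : ℕ → EReal} {p q : ℕ → ℝ} {ℓ : ℝ}
    (hL : ∀ m, Tendsto (exceedFreq x (L m)) atTop (𝓝 (p m))) (hp_pos : ∀ m, 0 < p m)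
    (hp : Tendsto p atTop (𝓝 0))
    (hLa : ∀ m, Tendsto (exceedFreq x (L m - a)) atTop (𝓝 (q m))) (hq : Tendsto q atTop (𝓝 ℓ))
    (hca : Tendsto (exceedFreq x (c - a)) atTop (𝓝 ℓ)) :
    Tendsto (fun n => nearCount x (k n) n a / n) atTop (𝓝 ℓ) := by
  have hlt : ∀ m, ∀ᶠ n in atTop, L m < orderStat x (k n) n := fun m =>
    eventually_lt_orderStat hk hklim (hp_pos m) (hL m)
  refine tendsto_order.2 ⟨fun b hb => ?_, fun b hb => ?_⟩
  · obtain ⟨m, hm⟩ := (hp.eventually_lt_const (sub_pos.2 hb)).exists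
    filter_upwards [hlt m, eventually_ge_atTop 1,
      (hca.sub (hL m)).eventually_const_lt (lt_sub_comm.1 hm)] with n hn hn1 hbn
    exact hbn.trans_le (exceedFreq_sub_le (orderStat_le (hk n hn1).1 (hk n hn1).2 hc) hn)
  · obtain ⟨m, hm⟩ := (hq.eventually_lt_const hb).exists
    filter_upwards [hlt m, (hLa m).eventually_lt_const hm] with n hn hbn
    exact (nearCount_div_le hn).trans_lt hbn

end OrderStatistics

section StationarySequence

variable {Ω : Type*} [MeasurableSpace Ω] {μ : Measure Ω} {X : ℕ → Ω → ℝ}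

theorem ae_tendsto_nearCount_div [IsFiniteMeasure μ] (hX : ∀ i, Measurable (X i))
    (hstat : StrictlyStationary μ X) {k : ℕ → ℕ} (hk : ∀ n, 1 ≤ n → 1 ≤ k n ∧ k n ≤ n)
    (hklim : Tendsto (fun n => (k n : ℝ) / (n : ℝ)) atTop (𝓝 1)) {a : ℝ} {γ : Ω → EReal}
    (hγ : IsCondRightEndpoint μ (invariantSigma X) (X 0) γ)
    (hγ0 : μ {ω | (X 0 ω : EReal) = γ ω} = 0)
    (hγa : μ {ω | (X 0 ω : EReal) = γ ω - (a : EReal)} = 0) :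
    ∀ᵐ ω ∂μ, Tendsto (fun n => nearCount (path X ω) (k n) n a / n) atTop
      (𝓝 (limitVariable μ (invariantSigma X) (X 0) γ a ω)) := by
  have hG := invariantSigma_le hX
  have hXγ := hγ.ae_le hG (hX 0)
  have hL : ∀ m, Measurable[invariantSigma X] fun ω => lowerApprox (γ ω) m := fun m =>
    (measurable_lowerApprox m).comp hγ.measurable
  filter_upwards [ae_forall_le hX hstat hγ.measurable hXγ,
    ae_all_iff.2 fun m => ae_tendsto_exceedFreq hX hstat (hL m),
    ae_all_iff.2 fun m => ae_tendsto_exceedFreq hX hstat ((measurable_sub_coe a).comp (hL m)),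
    ae_tendsto_exceedFreq hX hstat ((measurable_sub_coe a).comp hγ.measurable),
    ae_all_iff.2 fun m => hγ.condProb_pos_of_lt hG (hX 0) (hL m),
    hγ.ae_tendsto_condProb_lowerApprox_zero hG (hX 0) hγ0,
    ae_tendsto_condProb_lowerApprox hG (hX 0) (hγ.measurable.mono hG le_rfl) hγa,
    limitVariable_ae_eq hG (hX 0) hγ.measurable a]
    with ω hle hfreq hfreq_sub hfreq_γ hpos hp hq hlim
  have hγ_ne_bot : γ ω ≠ ⊥ := ne_bot_of_le_ne_bot (EReal.coe_ne_bot _) (hle 0)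
  rw [hlim]
  exact tendsto_nearCount_div hk hklim hle hfreq (fun m => hpos m (lowerApprox_lt hγ_ne_bot m)) hp
    hfreq_sub hq hfreq_γ

end StationarySequence

section Measurability

variable {Ω : Type*} {G m0 : MeasurableSpace Ω} {μ : Measure Ω} {X : ℕ → Ω → ℝ}

theorem measurable_orderStat (hX : ∀ i, Measurable (X i)) (k n : ℕ) :
    Measurable fun ω => orderStat (path X ω) k n := by
  by_cases h : 1 ≤ k ∧ k ≤ n
  · refine measurable_of_Iic fun y => ?_
    have hset : (fun ω => orderStat (path X ω) k n) ⁻¹' Set.Iic y =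
        {ω | k ≤ ∑ i ∈ Finset.range n, if X i ω ≤ y then 1 else 0} := by
      ext ω
      rw [Set.mem_preimage, Set.mem_Iic, ← EReal.coe_le_coe_iff, orderStat_le_iff h.1 h.2]
      simp only [Finset.card_filter, EReal.coe_le_coe_iff, path, Set.mem_ofPred_eq]
    rw [hset]
    exact measurableSet_le measurable_const <| Finset.measurable_sum _ fun i _ =>
      Measurable.ite (measurableSet_le (hX i) measurable_const) measurable_const measurable_const
  · simp only [orderStat, dif_neg h, measurable_const]

theorem measurable_nearCount (hX : ∀ i, Measurable (X i)) (k n : ℕ) (a : ℝ) :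
    Measurable fun ω => nearCount (path X ω) k n a := by
  have hord := measurable_orderStat hX k n
  exact Finset.measurable_sum _ fun i _ => (measurable_const (a := (1 : ℝ))).indicator <|
    (measurableSet_lt (hord.sub_const a) (hX i)).inter (measurableSet_lt (hX i) hord)

theorem measurable_limitVariable (hG : G ≤ m0) {γ : Ω → EReal} (hγ : Measurable[G] γ) (Z : Ω → ℝ)
    (a : ℝ) : Measurable (limitVariable μ G Z γ a) :=
  (measurable_const.indicator (hG _ (hγ measurableSet_Iio))).mul
    (stronglyMeasurable_condExp.measurable.mono hG le_rfl)

end Measurability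

section RandomIndex

variable {Ω E ι : Type*} [MeasurableSpace Ω] {μ : Measure Ω} [PseudoEMetricSpace E]

theorem tendstoInMeasure_comp_randomIndex [IsFiniteMeasure μ] {Y : ℕ → Ω → E} {Z : Ω → E}
    {l : Filter ι} {N : ι → Ω → ℕ} (hY : ∀ n, StronglyMeasurable (Y n)) (hZ : StronglyMeasurable Z)
    (hYZ : ∀ᵐ ω ∂μ, Tendsto (fun n => Y n ω) atTop (𝓝 (Z ω)))
    (hN : ∀ D : ℕ, Tendsto (fun i => μ {ω | N i ω ≤ D}) l (𝓝 0)) :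
    TendstoInMeasure μ (fun i ω => Y (N i ω) ω) l Z := by
  intro ε hε
  refine ENNReal.tendsto_nhds_zero.2 fun δ hδ => ?_
  obtain ⟨r, hr, hrδ⟩ := ENNReal.lt_iff_exists_nnreal_btwn.1 (ENNReal.half_pos hδ.ne')
  obtain ⟨t, -, ht, hunif⟩ := tendstoUniformlyOn_of_ae_tendsto' hY hZ hYZ
    (ε := r) (by exact_mod_cast hr)
  rw [ENNReal.ofReal_coe_nnreal] at ht
  obtain ⟨D, hD⟩ := eventually_atTop.1 (EMetric.tendstoUniformlyOn_iff.1 hunif ε hε)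
  have hsub : ∀ i, {ω | ε ≤ edist (Y (N i ω) ω) (Z ω)} ⊆ t ∪ {ω | N i ω ≤ D} := by
    intro i ω hω
    by_contra hmem
    rw [Set.mem_union, not_or, Set.mem_ofPred_eq, not_le] at hmem
    exact hω.not_gt (edist_comm (Z ω) _ ▸ hD _ hmem.2.le ω hmem.1)
  filter_upwards [ENNReal.tendsto_nhds_zero.1 (hN D) _ (ENNReal.half_pos hδ.ne')] with i hi
  calc μ {ω | ε ≤ edist (Y (N i ω) ω) (Z ω)}
    _ ≤ μ t + μ {ω | N i ω ≤ D} := (measure_mono (hsub i)).trans (measure_union_le _ _)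
    _ ≤ δ / 2 + δ / 2 := add_le_add (ht.trans hrδ.le) hi
    _ = δ := ENNReal.add_halves δ

end RandomIndex

end NearMax

theorem theorem4p1 {Ω : Type*} [MeasurableSpace Ω] (μ : Measure Ω) [IsProbabilityMeasure μ]
    (X : ℕ → Ω → ℝ) (hX : ∀ i, Measurable (X i)) (hstat : NearMax.StrictlyStationary μ X)
    (k : ℕ → ℕ) (hk : ∀ n, 1 ≤ n → 1 ≤ k n ∧ k n ≤ n)
    (hklim : Tendsto (fun n => (k n : ℝ) / (n : ℝ)) atTop (𝓝 1))
    (a : ℝ) (ha : 0 < a)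
    (γ : Ω → EReal)
    (hγ : NearMax.IsCondRightEndpoint μ (NearMax.invariantSigma X) (X 0) γ)
    (hγ0 : μ {ω | (X 0 ω : EReal) = γ ω} = 0)
    (hγa : μ {ω | (X 0 ω : EReal) = γ ω - (a : EReal)} = 0)
    (N : ℝ≥0 → Ω → ℕ) (hN : ∀ t, Measurable (N t)) :
    ((∀ᵐ ω ∂μ, Tendsto (fun t => N t ω) atTop atTop) →
      ∀ᵐ ω ∂μ, Tendsto (fun t => NearMax.randomNearCount X k (N t) a ω / (N t ω : ℝ)) atTop
        (𝓝 (NearMax.limitVariable μ (NearMax.invariantSigma X) (X 0) γ a ω))) ∧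
    (NearMax.TendstoInftyInProbability μ N →
      TendstoInMeasure μ (fun t ω => NearMax.randomNearCount X k (N t) a ω / (N t ω : ℝ)) atTop
        (NearMax.limitVariable μ (NearMax.invariantSigma X) (X 0) γ a)) := by
  have h := NearMax.ae_tendsto_nearCount_div hX hstat hk hklim hγ hγ0 hγa
  refine ⟨fun hNlim => ?_, fun hNlim => ?_⟩
  · filter_upwards [h, hNlim] with ω hω hNω using hω.comp hNω
  · exact NearMax.tendstoInMeasure_comp_randomIndex
      (fun n => ((NearMax.measurable_nearCount hX (k n) n a).div_const n).stronglyMeasurable)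
      (NearMax.measurable_limitVariable (NearMax.invariantSigma_le hX) hγ.measurable (X 0)
        a).stronglyMeasurable
      h fun D => by simpa only [Nat.cast_le] using hNlim D
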